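/- Formulae are built from a countable set $V$ of variables and the constants $0,1$ by the binary connectives $\backslash,\ /,\ \cdot,\ \oplus,\ \&$ and the unary connectives ${}^*$ (iteration) and $!$ (exponential). A sequent is an expression $\Pi\Rightarrow B$ with $\Pi$ a finite (possibly empty) sequence of formulae and $B$ a formula. Cut-free infinitary action logic with exponentiation has the following axioms and rules (premises before $\vdash$, conclusion after it; $n\geq 0$, $i\in\{1,2\}$; $A^n$ denotes the sequence $A,\dots,A$ of length $n$, and $!\Pi$ denotes $!A_1,\dots,!A_m$ for $\Pi=A_1,\dots,A_m$): - $\vdash A\Rightarrow A$; $\ \vdash\ \Rightarrow 1$; $\ \vdash\Gamma,0,\Delta\Rightarrow C$; $\ \Gamma,\Delta\Rightarrow C\ \vdash\ \Gamma,1,\Delta\Rightarrow C$; - $\Pi\Rightarrow A;\ \Gamma,B,\Delta\Rightarrow C\ \vdash\ \Gamma,\Pi,A\backslash B,\Delta\Rightarrow C$; $\ A,\Pi\Rightarrow B\ \vdash\ \Pi\Rightarrow A\backslash B$; - $\Pi\Rightarrow A;\ \Gamma,B,\Delta\Rightarrow C\ \vdash\ \Gamma,B/A,\Pi,\Delta\Rightarrow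 C$; $\ \Pi,A\Rightarrow B\ \vdash\ \Pi\Rightarrow B/A$; - $\Gamma,A,B,\Delta\Rightarrow C\ \vdash\ \Gamma,A\cdot B,\Delta\Rightarrow C$; $\ \Gamma\Rightarrow A;\ \Delta\Rightarrow B\ \vdash\ \Gamma,\Delta\Rightarrow A\cdot B$; - $\Gamma,A_1,\Delta\Rightarrow C;\ \Gamma,A_2,\Delta\Rightarrow C\ \vdash\ \Gamma,A_1\oplus A_2,\Delta\Rightarrow C$; $\ \Pi\Rightarrow A_i\ \vdash\ \Pi\Rightarrow A_1\oplus A_2$; - $\Gamma,A_i,\Delta\Rightarrow C\ \vdash\ \Gamma,A_1\&A_2,\Delta\Rightarrow C$; $\ \Pi\Rightarrow A_1;\ \Pi\Rightarrow A_2\ \vdash\ \Pi\Rightarrow A_1\&A_2$; - $\Pi_1\Rightarrow A;\dots;\Pi_n\Rightarrow A\ \vdash\ \Pi_1,\dots,\Pi_n\Rightarrow A^*$; - $\Gamma,A,\Delta\Rightarrow C\ \vdash\ \Gamma,!A,\Delta\Rightarrow C$; $\ !\Pi\Rightarrow B\ \vdash\ !\Pi\Rightarrow\, !B$; $\ \Gamma,\Pi,!A,\Delta\Rightarrow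 C\ \vdash\ \Gamma,!A,\Pi,\Delta\Rightarrow C$ and conversely; $\ \Gamma,\Delta\Rightarrow C\ \vdash\ \Gamma,!A,\Delta\Rightarrow C$; $\ \Gamma,!A,!A,\Delta\Rightarrow C\ \vdash\ \Gamma,!A,\Delta\Rightarrow C$; - the $\omega$-rule $({}^*L_\omega)$: $\ (\Gamma,A^n,\Delta\Rightarrow C)_{n\in\omega}\ \vdash\ \Gamma,A^*,\Delta\Rightarrow C$. Let $!\mathbf{ACT}_\omega^-$ be the restriction of this calculus to sequents in which ${}^*$ does not occur in the scope of $!$. Let $!\underline{\mathbf{ACT}}_\omega^-$ be the calculus on the same sequents with exactly two rules: the $\omega$-rule, and the rule $(\mathrm{Fin})$, by which $s$ is obtained from a finite list $s_1,\dots,s_m$ ($m\geq 0$) iff $s$ is derivable from $s_1,\dots,s_m$ in $!\mathbf{ACT}_\omega^-$ without using the $\omega$-rule. For each of these calculi $\mathbf L$, its immediate derivability operator $\mathscr D_{\mathbf L}$ maps a set $S$ of sequents of the calculus to the set of all sequents of the calculus that belong to $S$ or are obtained from elements of $S$ by one application of a rule (or axiom) of $\mathbf L$. For a monotone operator $F$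 on sets, let $F^0(\varnothing)=\varnothing$, $F^{\beta+1}(\varnothing)=F(F^\beta(\varnothing))$, and $F^\alpha(\varnothing)=\bigcup_{\beta<\alpha}F^\beta(\varnothing)$ for nonzero limit $\alpha$; the closure ordinal of $F$ is the least ordinal $\alpha$ with $F^{\alpha+1}(\varnothing)=F^\alpha(\varnothing)$. **Theorem.** The closure ordinals of the immediate derivability operators of $!\underline{\mathbf{ACT}}_\omega^-$ and of $!\mathbf{ACT}_\omega^-$ are less than or equal to $\omega^\omega$. -/

import Mathlib

namespace ActOmega

/-- Formulae with exponential over a set `V` of variables. -/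
inductive Formula (V : Type) : Type
  | var : V → Formula V
  | zero : Formula V
  | one : Formula V
  /-- `ldiv A B` is `A \ B`. -/
  | ldiv : Formula V → Formula V → Formula V
  /-- `rdiv B A` is `B / A`. -/
  | rdiv : Formula V → Formula V → Formula V
  /-- `prod A B` is the product of `A` and `B`. -/
  | prod : Formula V → Formula V → Formula V
  /-- `plus A B` is the join `A ⊕ B`. -/
  | plus : Formula V → Formula V → Formula V
  /-- `meet A B` is `A & B`. -/
  | meet : Formula V → Formula V → Formula V
  /-- `star A` is the iteration `A*`. -/
  | star : Formula V → Formula V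
  /-- `bang A` is `!A`. -/
  | bang : Formula V → Formula V

namespace Formula

variable {V : Type}

/-- The iteration `*` does not occur in the formula. -/
def StarFree : Formula V → Prop
  | var _ => True
  | zero => True
  | one => True
  | ldiv A B => A.StarFree ∧ B.StarFree
  | rdiv A B => A.StarFree ∧ B.StarFree
  | prod A B => A.StarFree ∧ B.StarFree
  | plus A B => A.StarFree ∧ B.StarFree
  | meet A B => A.StarFree ∧ B.StarFree
  | star _ => False
  | bang A => A.StarFree

/-- The iteration `*` does not occur in the scope of `!`: every subformula
of the form `!A` is free of `*`. -/
def NoStarUnderBang : Formula V → Prop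
  | var _ => True
  | zero => True
  | one => True
  | ldiv A B => A.NoStarUnderBang ∧ B.NoStarUnderBang
  | rdiv A B => A.NoStarUnderBang ∧ B.NoStarUnderBang
  | prod A B => A.NoStarUnderBang ∧ B.NoStarUnderBang
  | plus A B => A.NoStarUnderBang ∧ B.NoStarUnderBang
  | meet A B => A.NoStarUnderBang ∧ B.NoStarUnderBang
  | star A => A.NoStarUnderBang
  | bang A => A.StarFree

end Formula

/-- A sequent `Θ ⇒ B`, with `Θ` a finite, possibly empty, sequence of formulae. -/
structure Sequent (V : Type) : Type where
  ante : List (Formula V)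
  succ : Formula V

infix:25 " ⟹ " => Sequent.mk

open Formula in
/-- `FinRule ps s`: the sequent `s` is obtained from the finite list of premises `ps`
by one application of an axiom or of a rule other than the `ω`-rule (and other than Cut,
as derivations are cut-free). -/
inductive FinRule {V : Type} : List (Sequent V) → Sequent V → Prop
  | id (A : Formula V) : FinRule [] ([A] ⟹ A)
  | ldivL (Γ Θ Δ : List (Formula V)) (A B C : Formula V) :
      FinRule [Θ ⟹ A, Γ ++ [B] ++ Δ ⟹ C] (Γ ++ Θ ++ [ldiv A B] ++ Δ ⟹ C)
  | ldivR (Θ : List (Formula V)) (A B : Formula V) :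
      FinRule [[A] ++ Θ ⟹ B] (Θ ⟹ ldiv A B)
  | rdivL (Γ Θ Δ : List (Formula V)) (A B C : Formula V) :
      FinRule [Θ ⟹ A, Γ ++ [B] ++ Δ ⟹ C] (Γ ++ [rdiv B A] ++ Θ ++ Δ ⟹ C)
  | rdivR (Θ : List (Formula V)) (A B : Formula V) :
      FinRule [Θ ++ [A] ⟹ B] (Θ ⟹ rdiv B A)
  | prodL (Γ Δ : List (Formula V)) (A B C : Formula V) :
      FinRule [Γ ++ [A, B] ++ Δ ⟹ C] (Γ ++ [prod A B] ++ Δ ⟹ C)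
  | prodR (Γ Δ : List (Formula V)) (A B : Formula V) :
      FinRule [Γ ⟹ A, Δ ⟹ B] (Γ ++ Δ ⟹ prod A B)
  | oneL (Γ Δ : List (Formula V)) (C : Formula V) :
      FinRule [Γ ++ Δ ⟹ C] (Γ ++ [one] ++ Δ ⟹ C)
  | oneR : FinRule [] ([] ⟹ one)
  | zeroL (Γ Δ : List (Formula V)) (C : Formula V) :
      FinRule [] (Γ ++ [zero] ++ Δ ⟹ C)
  | plusL (Γ Δ : List (Formula V)) (A₁ A₂ C : Formula V) :
      FinRule [Γ ++ [A₁] ++ Δ ⟹ C, Γ ++ [A₂] ++ Δ ⟹ C] (Γ ++ [plus A₁ A₂] ++ Δ ⟹ C)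
  | plusR₁ (Θ : List (Formula V)) (A₁ A₂ : Formula V) :
      FinRule [Θ ⟹ A₁] (Θ ⟹ plus A₁ A₂)
  | plusR₂ (Θ : List (Formula V)) (A₁ A₂ : Formula V) :
      FinRule [Θ ⟹ A₂] (Θ ⟹ plus A₁ A₂)
  | meetL₁ (Γ Δ : List (Formula V)) (A₁ A₂ C : Formula V) :
      FinRule [Γ ++ [A₁] ++ Δ ⟹ C] (Γ ++ [meet A₁ A₂] ++ Δ ⟹ C)
  | meetL₂ (Γ Δ : List (Formula V)) (A₁ A₂ C : Formula V) :
      FinRule [Γ ++ [A₂] ++ Δ ⟹ C] (Γ ++ [meet A₁ A₂] ++ Δ ⟹ C)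
  | meetR (Θ : List (Formula V)) (A₁ A₂ : Formula V) :
      FinRule [Θ ⟹ A₁, Θ ⟹ A₂] (Θ ⟹ meet A₁ A₂)
  /-- From `Θ₁ ⇒ A`, …, `Θₙ ⇒ A` infer `Θ₁, …, Θₙ ⇒ A*`, for every `n ≥ 0`. -/
  | starR (Θs : List (List (Formula V))) (A : Formula V) :
      FinRule (Θs.map fun Θ => (Θ ⟹ A)) (Θs.flatten ⟹ star A)
  | bangL (Γ Δ : List (Formula V)) (A C : Formula V) :
      FinRule [Γ ++ [A] ++ Δ ⟹ C] (Γ ++ [bang A] ++ Δ ⟹ C)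
  | bangR (Θ : List (Formula V)) (B : Formula V) :
      FinRule [Θ.map bang ⟹ B] (Θ.map bang ⟹ bang B)
  | bangP₁ (Γ Θ Δ : List (Formula V)) (A C : Formula V) :
      FinRule [Γ ++ Θ ++ [bang A] ++ Δ ⟹ C] (Γ ++ [bang A] ++ Θ ++ Δ ⟹ C)
  | bangP₂ (Γ Θ Δ : List (Formula V)) (A C : Formula V) :
      FinRule [Γ ++ [bang A] ++ Θ ++ Δ ⟹ C] (Γ ++ Θ ++ [bang A] ++ Δ ⟹ C)
  | bangW (Γ Δ : List (Formula V)) (A C : Formula V) :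
      FinRule [Γ ++ Δ ⟹ C] (Γ ++ [bang A] ++ Δ ⟹ C)
  | bangC (Γ Δ : List (Formula V)) (A C : Formula V) :
      FinRule [Γ ++ [bang A, bang A] ++ Δ ⟹ C] (Γ ++ [bang A] ++ Δ ⟹ C)

/-- `OmegaRule p s`: the sequent `s` is obtained from the premises `p 0, p 1, …` by one
application of the `ω`-rule: from `Γ, Aⁿ, Δ ⇒ C` for all `n`, infer `Γ, A*, Δ ⇒ C`.
Here `Aⁿ` is the sequence `A, …, A` of length `n`. -/
inductive OmegaRule {V : Type} : (ℕ → Sequent V) → Sequent V → Prop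
  | starL (Γ Δ : List (Formula V)) (A C : Formula V) :
      OmegaRule (fun n => (Γ ++ List.replicate n A ++ Δ ⟹ C)) (Γ ++ [Formula.star A] ++ Δ ⟹ C)

/-- The sequents of the fragment: those with no `*` in the scope of `!`. -/
abbrev MinusSequent (V : Type) : Type :=
  {s : Sequent V // (∀ A ∈ s.ante, A.NoStarUnderBang) ∧ s.succ.NoStarUnderBang}

/-- One application of a rule other than the `ω`-rule, within the fragment. -/
def MinusFinRule {V : Type} (ps : List (MinusSequent V)) (s : MinusSequent V) : Prop :=
  FinRule (ps.map Subtype.val) s.val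

/-- One application of the `ω`-rule, within the fragment. -/
def MinusOmegaRule {V : Type} (p : ℕ → MinusSequent V) (s : MinusSequent V) : Prop :=
  OmegaRule (fun n => (p n).val) s.val

/-- `FinDerivable hs s`: `s` is derivable from the hypotheses `hs` within the fragment
without using the `ω`-rule. -/
inductive FinDerivable {V : Type} (hs : List (MinusSequent V)) : MinusSequent V → Prop
  | hyp (s : MinusSequent V) : s ∈ hs → FinDerivable hs s
  | step (ps : List (MinusSequent V)) (s : MinusSequent V) :
      MinusFinRule ps s → (∀ p ∈ ps, FinDerivable hs p) → FinDerivable hs s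

/-- The immediate derivability operator of the fragment. -/
def immDer (V : Type) (S : Set (MinusSequent V)) : Set (MinusSequent V) :=
  {s | s ∈ S ∨
    (∃ ps : List (MinusSequent V), (∀ p ∈ ps, p ∈ S) ∧ MinusFinRule ps s) ∨
    (∃ p : ℕ → MinusSequent V, (∀ n, p n ∈ S) ∧ MinusOmegaRule p s)}

/-- The immediate derivability operator of the calculus over the same sequents whose only
rules are (Fin), which infers `s` from any finite list `hs` such that `s` is derivable from
`hs` without the `ω`-rule, and the `ω`-rule. -/
def immDerFin (V : Type) (S : Set (MinusSequent V)) : Set (MinusSequent V) :=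
  {s | s ∈ S ∨
    (∃ hs : List (MinusSequent V), (∀ p ∈ hs, p ∈ S) ∧ FinDerivable hs s) ∨
    (∃ p : ℕ → MinusSequent V, (∀ n, p n ∈ S) ∧ MinusOmegaRule p s)}

/-- The transfinite iterates of `F` from `S`: `F⁰(S) = S`, `F^(β+1)(S) = F(F^β(S))`, and
`F^α(S)` is the union of the `F^β(S)`, `β < α`, for a limit ordinal `α`. -/
noncomputable def iter {X : Type} (F : Set X → Set X) (S : Set X) (α : Ordinal.{0}) : Set X :=
  Ordinal.limitRecOn α S (fun _ T => F T) (fun α _ T => ⋃ β : Set.Iio α, T β.1 β.2)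

/-- `α` is the closure ordinal of `F`: the least ordinal with `F^(α+1)(∅) = F^α(∅)`. -/
def IsClosureOrdinal {X : Type} (F : Set X → Set X) (α : Ordinal.{0}) : Prop :=
  IsLeast {β : Ordinal.{0} | iter F ∅ (β + 1) = iter F ∅ β} α

end ActOmega

/-!
A sequent is measured by the ordinal `∑ d, ω ^ d * k d`, where `k d` is the number of occurrences
of iterations `A*` of star height `d + 1` in it.  In every rule other than the `ω`-rule, each
premise has at most the measure of the conclusion (`FinRule.count_le`): the only rule that
duplicates a formula within one premise is contraction, and it acts on formulae `!A`, which contain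
no iteration in the fragment.  In the `ω`-rule an iteration `A*` is replaced by copies of `A`, in
which all iterations have smaller star height, so each premise has a strictly smaller measure
(`OmegaRule.measure_lt`).

Hence, if all derivable sequents of measure less than `α` are reached by stage `ω * α`, then those
of measure `α` are reached by stage `ω * α + ω = ω * (α + 1)`: conclusions of the `ω`-rule appear
at stage `ω * α + 1`, and what remains is a finite derivation with finitary rules
(`mem_iter_omega0_mul`).  This applies to both operators.  As all measures are below `ω ^ ω`,
everything derivable is reached before `ω ^ ω` (`exists_isClosureOrdinal_le`).
-/

namespace ActOmega

open Ordinal Order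

/-! ### Iterates of operators that decrease a measure at infinitary steps -/

section Iterates

variable {X : Type} {F : Set X → Set X} {S : Set X}

theorem iter_zero : iter F S 0 = S := limitRecOn_zero ..

theorem iter_add_one (α : Ordinal.{0}) : iter F S (α + 1) = F (iter F S α) :=
  limitRecOn_add_one ..

theorem mem_iter_of_isSuccLimit {α : Ordinal.{0}} (hα : IsSuccLimit α) {x : X} :
    x ∈ iter F S α ↔ ∃ β < α, x ∈ iter F S β := by
  have h : iter F S α = ⋃ β : Set.Iio α, iter F S β.1 := limitRecOn_limit _ _ _ _ hα
  simp [h]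

theorem iter_mono (hF : ∀ T, T ⊆ F T) {α β : Ordinal.{0}} (h : α ≤ β) :
    iter F S α ⊆ iter F S β := by
  induction β using limitRecOn with
  | zero => rw [nonpos_iff_eq_zero.1 h]
  | add_one β ih =>
    rcases h.eq_or_lt with rfl | h
    · rfl
    · exact (ih (lt_add_one_iff.1 h)).trans ((hF _).trans (iter_add_one β).ge)
  | limit β hβ _ =>
    rcases h.eq_or_lt with rfl | h
    · rfl
    · exact fun x hx => (mem_iter_of_isSuccLimit hβ).2 ⟨α, h, hx⟩

/-- A finite set is contained in the iterate at a limit ordinal only if it is contained in an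
earlier iterate. -/
theorem exists_lt_finite_subset_iter (hF : ∀ T, T ⊆ F T) {α : Ordinal.{0}} (hα : IsSuccLimit α)
    {t : Set X} (ht : t.Finite) (h : t ⊆ iter F S α) : ∃ β < α, t ⊆ iter F S β := by
  induction t, ht using Set.Finite.induction_on with
  | empty => exact ⟨0, hα.bot_lt, Set.empty_subset _⟩
  | @insert x t _ _ ih =>
    obtain ⟨β, hβ, htβ⟩ := ih ((Set.subset_insert _ _).trans h)
    obtain ⟨γ, hγ, hx⟩ := (mem_iter_of_isSuccLimit hα).1 (h (Set.mem_insert _ _))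
    exact ⟨max β γ, max_lt hβ hγ, Set.insert_subset (iter_mono hF (le_max_right ..) hx)
      (htβ.trans (iter_mono hF (le_max_left ..)))⟩

/-- `DecreasesAlong F μ` holds if each element of `F T` is in `T`, or is obtained by `F` from
finitely many elements of `T` of at most the same measure, or is obtained by `F` from elements of
`T` of strictly smaller measure. -/
def DecreasesAlong (F : Set X → Set X) (μ : X → Ordinal.{0}) : Prop :=
  ∀ T, ∀ x ∈ F T, x ∈ T ∨
    (∃ t : Set X, t.Finite ∧ t ⊆ {y ∈ T | μ y ≤ μ x} ∧ x ∈ F t) ∨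
    x ∈ F {y ∈ T | μ y < μ x}

/-- The bound `ω * (μ x + 1)` leaves `ω` further stages for the finitary steps that follow the
infinitary steps whose premises have smaller measure. -/
theorem mem_iter_omega0_mul (hF : ∀ T, T ⊆ F T) (hmono : Monotone F) {μ : X → Ordinal.{0}}
    (h : DecreasesAlong F μ) {x : X} {β : Ordinal.{0}} (hx : x ∈ iter F ∅ β) :
    x ∈ iter F ∅ (ω * (μ x + 1)) := by
  suffices H : ∀ α : Ordinal.{0}, ∀ β : Ordinal.{0}, ∀ x ∈ iter F ∅ β, μ x ≤ α →
      x ∈ iter F ∅ (ω * (α + 1)) from H _ β x hx le_rfl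
  intro α
  induction α using WellFoundedLT.induction with
  | ind α ihα =>
  have hlim : IsSuccLimit (ω * (α + 1)) := by
    rw [mul_add_one]
    exact isSuccLimit_add _ isSuccLimit_omega0
  intro β
  induction β using limitRecOn with
  | zero =>
    intro x hx
    simp [iter_zero] at hx
  | add_one β ihβ =>
    intro x hx hxα
    rw [iter_add_one] at hx
    obtain hx | ⟨t, ht, htβ, hx⟩ | hx := h _ x hx
    · exact ihβ x hx hxα
    · obtain ⟨γ, hγ, htγ⟩ := exists_lt_finite_subset_iter hF hlim ht
        fun y hy => ihβ y (htβ hy).1 ((htβ hy).2.trans hxα)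
      refine iter_mono hF (hlim.succ_lt hγ).le ?_
      rw [succ_eq_add_one, iter_add_one]
      exact hmono htγ hx
    · have hsub : {y ∈ iter F ∅ β | μ y < μ x} ⊆ iter F ∅ (ω * α) := by
        rintro y ⟨hy, hyx⟩
        have hyα := hyx.trans_le hxα
        exact iter_mono hF (mul_le_mul_right (add_one_le_iff.2 hyα) ω)
          (ihα _ hyα β y hy le_rfl)
      have hle : ω * α + 1 ≤ ω * (α + 1) := by
        rw [mul_add_one]
        gcongr
        exact one_lt_omega0.le
      refine iter_mono hF hle ?_
      rw [iter_add_one]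
      exact hmono hsub hx
  | limit β hβ ihβ =>
    intro x hx hxα
    obtain ⟨γ, hγ, hxγ⟩ := (mem_iter_of_isSuccLimit hβ).1 hx
    exact ihβ γ hγ x hxγ hxα

theorem exists_isClosureOrdinal_le (hF : ∀ T, T ⊆ F T) (hmono : Monotone F)
    {μ : X → Ordinal.{0}} (h : DecreasesAlong F μ) (hμ : ∀ x, μ x < ω ^ ω) :
    ∃ α : Ordinal.{0}, IsClosureOrdinal F α ∧ α ≤ ω ^ ω := by
  have hfix : (ω ^ ω : Ordinal.{0}) ∈ {β : Ordinal.{0} | iter F ∅ (β + 1) = iter F ∅ β} := by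
    refine Set.Subset.antisymm (fun x hx => ?_) (iter_mono hF (le_add_right le_rfl))
    refine iter_mono hF ?_ (mem_iter_omega0_mul hF hmono h hx)
    obtain ⟨n, hn, hxn⟩ := (lt_opow_of_isSuccLimit omega0_ne_zero isSuccLimit_omega0).1 (hμ x)
    calc ω * (μ x + 1) ≤ ω * ω ^ n := mul_le_mul_right (add_one_le_iff.2 hxn) ω
      _ = ω ^ (1 + n) := by rw [opow_add, opow_one]
      _ ≤ ω ^ ω := opow_le_opow_right omega0_pos (isPrincipal_add_omega0 one_lt_omega0 hn).le
  exact ⟨_, ⟨csInf_mem ⟨_, hfix⟩, fun β hβ => csInf_le' hβ⟩, csInf_le' hfix⟩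

end Iterates

/-! ### Ordinals below `ω ^ ω` from their coefficients -/

/-- `polyOrd k n` is the ordinal `ω ^ (n - 1) * k (n - 1) + ⋯ + ω * k 1 + k 0`. -/
noncomputable def polyOrd (k : ℕ → ℕ) : ℕ → Ordinal.{0}
  | 0 => 0
  | n + 1 => ω ^ n * k n + polyOrd k n

theorem polyOrd_mono (k : ℕ → ℕ) : Monotone (polyOrd k) :=
  monotone_nat_of_le_succ fun _ => le_add_left le_rfl

theorem polyOrd_le_polyOrd {k l : ℕ → ℕ} (h : ∀ d, k d ≤ l d) (n : ℕ) :
    polyOrd k n ≤ polyOrd l n := by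
  induction n with
  | zero => rfl
  | succ n ih =>
    have := h n
    rw [polyOrd, polyOrd]
    gcongr

theorem polyOrd_lt_omega0_pow (k : ℕ → ℕ) (n : ℕ) : polyOrd k n < ω ^ n := by
  induction n with
  | zero => simp [polyOrd]
  | succ n ih =>
    calc ω ^ n * k n + polyOrd k n < ω ^ n * k n + ω ^ n := by gcongr
      _ = ω ^ n * ((k n + 1 : ℕ) : Ordinal) := by rw [Nat.cast_add_one, mul_add_one]
      _ < ω ^ n * ω := by
        gcongr
        · exact pow_pos omega0_pos n
        · exact natCast_lt_omega0 _
      _ = ω ^ (n + 1) := (pow_succ ..).symm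

/-- Strict monotonicity for the lexicographic order in which larger indices are more
significant. -/
theorem polyOrd_lt_polyOrd {k l : ℕ → ℕ} {d : ℕ} (hd : k d < l d) (h : ∀ e > d, k e ≤ l e)
    {n : ℕ} (hn : d < n) : polyOrd k n < polyOrd l n := by
  induction n, hn using Nat.le_induction with
  | base =>
    calc ω ^ d * k d + polyOrd k d < ω ^ d * k d + ω ^ d := by
          gcongr
          exact polyOrd_lt_omega0_pow k d
      _ = ω ^ d * ((k d + 1 : ℕ) : Ordinal) := by rw [Nat.cast_add_one, mul_add_one]
      _ ≤ ω ^ d * l d := by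
        gcongr
        exact hd
      _ ≤ ω ^ d * l d + polyOrd l d := le_add_right le_rfl
  | succ n hn ih =>
    have := h n hn
    rw [polyOrd, polyOrd]
    exact (add_lt_add_right ih _).trans_le (by gcongr)

/-! ### Counting iterations by star height -/

namespace Formula

variable {V : Type}

/-- The star height: the largest number of nested iterations. -/
def height : Formula V → ℕ
  | var _ => 0
  | zero => 0
  | one => 0
  | ldiv A B => max A.height B.height
  | rdiv A B => max A.height B.height
  | prod A B => max A.height B.height
  | plus A B => max A.height B.height
  | meet A B => max A.height B.height
  | star A => A.height + 1
  | bang A => A.height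

/-- `A.count d` is the number of occurrences in `A` of subformulae `B*` with `B` of star
height `d`. -/
def count : Formula V → ℕ → ℕ
  | var _, _ => 0
  | zero, _ => 0
  | one, _ => 0
  | ldiv A B, d => A.count d + B.count d
  | rdiv A B, d => A.count d + B.count d
  | prod A B, d => A.count d + B.count d
  | plus A B, d => A.count d + B.count d
  | meet A B, d => A.count d + B.count d
  | star A, d => A.count d + if d = A.height then 1 else 0
  | bang A, d => A.count d

theorem count_eq_zero_of_height_le (A : Formula V) {d : ℕ} (h : A.height ≤ d) :
    A.count d = 0 := by
  induction A <;> grind [height, count]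

theorem StarFree.count_eq_zero {A : Formula V} (h : A.StarFree) (d : ℕ) : A.count d = 0 := by
  induction A <;> grind [StarFree, count]

/-- The largest star height in a sequence of formulae. -/
def listHeight : List (Formula V) → ℕ
  | [] => 0
  | A :: Γ => max A.height (listHeight Γ)

/-- The number of occurrences in a sequence of formulae of subformulae `B*` with `B` of star
height `d`. -/
def listCount (d : ℕ) : List (Formula V) → ℕ
  | [] => 0
  | A :: Γ => A.count d + listCount d Γ

theorem listHeight_append (Γ Δ : List (Formula V)) :
    listHeight (Γ ++ Δ) = max (listHeight Γ) (listHeight Δ) := by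
  induction Γ <;> grind [listHeight]

theorem listCount_append (d : ℕ) (Γ Δ : List (Formula V)) :
    listCount d (Γ ++ Δ) = listCount d Γ + listCount d Δ := by
  induction Γ <;> grind [listCount]

theorem listHeight_replicate_le (n : ℕ) (A : Formula V) :
    listHeight (List.replicate n A) ≤ A.height := by
  induction n <;> simp_all [listHeight, List.replicate_succ]

theorem listCount_replicate (d n : ℕ) (A : Formula V) :
    listCount d (List.replicate n A) = n * A.count d := by
  induction n with
  | zero => simp [listCount]
  | succ n ih => rw [List.replicate_succ, listCount, ih]; ring

theorem listHeight_le_flatten {Θs : List (List (Formula V))} {Θ : List (Formula V)}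
    (h : Θ ∈ Θs) : listHeight Θ ≤ listHeight Θs.flatten := by
  induction Θs with
  | nil => simp at h
  | cons Γ Θs ih =>
    rw [List.flatten_cons, listHeight_append]
    grind

theorem listCount_le_flatten (d : ℕ) {Θs : List (List (Formula V))} {Θ : List (Formula V)}
    (h : Θ ∈ Θs) : listCount d Θ ≤ listCount d Θs.flatten := by
  induction Θs with
  | nil => simp at h
  | cons Γ Θs ih =>
    rw [List.flatten_cons, listCount_append]
    grind

end Formula

variable {V : Type}

open Formula

namespace Sequent

/-- The largest star height of a formula of the sequent. -/
def height (s : Sequent V) : ℕ := max (listHeight s.ante) s.succ.height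

/-- The number of occurrences in the sequent of subformulae `B*` with `B` of star height `d`. -/
def count (s : Sequent V) (d : ℕ) : ℕ := listCount d s.ante + s.succ.count d

/-- The ordinal `∑ d, ω ^ d * s.count d`; the terms with `d ≥ s.height` vanish. -/
noncomputable def measure (s : Sequent V) : Ordinal.{0} := polyOrd s.count s.height

theorem measure_lt_opow (s : Sequent V) : s.measure < ω ^ ω :=
  (polyOrd_lt_omega0_pow _ _).trans <| by
    rw [← opow_natCast]
    exact (opow_lt_opow_iff_right one_lt_omega0).2 (natCast_lt_omega0 _)

end Sequent

/-! ### The measure along the rules -/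

theorem FinRule.height_le {ps : List (Sequent V)} {s : Sequent V} (h : FinRule ps s) :
    ∀ p ∈ ps, p.height ≤ s.height := by
  cases h with
  | starR Θs A =>
    simp only [List.mem_map]
    rintro _ ⟨Θ, hΘ, rfl⟩
    have := listHeight_le_flatten hΘ
    simp only [Sequent.height, Formula.height]
    omega
  | _ =>
    simp only [List.mem_cons, List.not_mem_nil, or_false, forall_eq_or_imp, forall_eq,
      false_imp_iff, implies_true, Sequent.height, listHeight_append, listHeight, Formula.height]
    try omega

/-- Only contraction needs the restriction to the fragment, by which the duplicated formula is
free of iterations. -/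
theorem FinRule.count_le {ps : List (Sequent V)} {s : Sequent V} (h : FinRule ps s)
    (hs : ∀ A ∈ s.ante, A.NoStarUnderBang) (d : ℕ) : ∀ p ∈ ps, p.count d ≤ s.count d := by
  cases h with
  | starR Θs A =>
    simp only [List.mem_map]
    rintro _ ⟨Θ, hΘ, rfl⟩
    have := listCount_le_flatten d hΘ
    simp only [Sequent.count, Formula.count]
    omega
  | bangC Γ Δ A C =>
    have hA : A.StarFree := hs (bang A) (by simp)
    simp [Sequent.count, listCount_append, listCount, Formula.count, hA.count_eq_zero]
  | _ =>
    simp only [List.mem_cons, List.not_mem_nil, or_false, forall_eq_or_imp, forall_eq,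
      false_imp_iff, implies_true, Sequent.count, listCount_append, listCount, Formula.count]
    try omega

theorem MinusFinRule.measure_le {ps : List (MinusSequent V)} {s : MinusSequent V}
    (h : MinusFinRule ps s) : ∀ p ∈ ps, p.val.measure ≤ s.val.measure := fun p hp =>
  have hp' := List.mem_map_of_mem hp
  (polyOrd_le_polyOrd (fun d => FinRule.count_le h s.2.1 d p.val hp') _).trans
    (polyOrd_mono _ (FinRule.height_le h p.val hp'))

theorem OmegaRule.measure_lt {p : ℕ → Sequent V} {s : Sequent V} (h : OmegaRule p s) (n : ℕ) :
    (p n).measure < s.measure := by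
  obtain ⟨Γ, Δ, A, C⟩ := h
  have hA := listHeight_replicate_le n A
  -- The most significant coefficient that changes is the one that counts `A*` itself.
  refine (polyOrd_mono _ ?_).trans_lt (polyOrd_lt_polyOrd (d := A.height) ?_ ?_ ?_)
  · simp only [Sequent.height, listHeight_append, listHeight, Formula.height]
    omega
  · simp [Sequent.count, listCount_append, listCount, Formula.count, listCount_replicate,
      A.count_eq_zero_of_height_le le_rfl]
  · intro e he
    simp [Sequent.count, listCount_append, listCount, Formula.count, listCount_replicate,
      A.count_eq_zero_of_height_le he.le]
  · simp only [Sequent.height, listHeight_append, listHeight, Formula.height]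
    omega

/-- A derivation with finitary rules uses only hypotheses of at most the measure of its
conclusion. -/
theorem FinDerivable.filter_measure_le {hs : List (MinusSequent V)} {s : MinusSequent V}
    (h : FinDerivable hs s) {α : Ordinal.{0}} (hα : s.val.measure ≤ α) :
    FinDerivable (hs.filter fun p => p.val.measure ≤ α) s := by
  induction h with
  | hyp s hs => exact .hyp s (by simp [hs, hα])
  | step ps s hr _ ih => exact .step ps s hr fun p hp => ih p hp ((hr.measure_le p hp).trans hα)

/-! ### The two immediate derivability operators -/

theorem monotone_immDer : Monotone (immDer V) := by
  rintro S T h s (hs | ⟨ps, hps, hr⟩ | ⟨p, hp, hr⟩)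
  · exact .inl (h hs)
  · exact .inr (.inl ⟨ps, fun p hp => h (hps p hp), hr⟩)
  · exact .inr (.inr ⟨p, fun n => h (hp n), hr⟩)

theorem monotone_immDerFin : Monotone (immDerFin V) := by
  rintro S T h s (hs | ⟨ps, hps, hr⟩ | ⟨p, hp, hr⟩)
  · exact .inl (h hs)
  · exact .inr (.inl ⟨ps, fun p hp => h (hps p hp), hr⟩)
  · exact .inr (.inr ⟨p, fun n => h (hp n), hr⟩)

theorem decreasesAlong_immDer : DecreasesAlong (immDer V) fun s => s.val.measure := by
  rintro S s (hs | ⟨ps, hps, hr⟩ | ⟨p, hp, hr⟩)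
  · exact .inl hs
  · exact .inr <| .inl ⟨{p | p ∈ ps}, ps.finite_toSet,
      fun p hp => ⟨hps p hp, hr.measure_le p hp⟩, .inr (.inl ⟨ps, fun _ => id, hr⟩)⟩
  · exact .inr <| .inr <| .inr <| .inr ⟨p, fun n => ⟨hp n, OmegaRule.measure_lt hr n⟩, hr⟩

theorem decreasesAlong_immDerFin : DecreasesAlong (immDerFin V) fun s => s.val.measure := by
  rintro S s (hs | ⟨ps, hps, hr⟩ | ⟨p, hp, hr⟩)
  · exact .inl hs
  · refine .inr <| .inl ⟨{p | p ∈ ps.filter fun p => p.val.measure ≤ s.val.measure},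
      List.finite_toSet _, fun p hp => ?_,
      .inr (.inl ⟨_, fun _ => id, hr.filter_measure_le le_rfl⟩)⟩
    simp only [List.mem_filter, Set.mem_ofPred_eq, decide_eq_true_eq] at hp
    exact ⟨hps p hp.1, hp.2⟩
  · exact .inr <| .inr <| .inr <| .inr ⟨p, fun n => ⟨hp n, OmegaRule.measure_lt hr n⟩, hr⟩

end ActOmega

theorem theorem5p2 (V : Type) [Countable V] :
    (∃ α : Ordinal.{0}, ActOmega.IsClosureOrdinal (ActOmega.immDerFin V) α ∧
      α ≤ Ordinal.omega0 ^ Ordinal.omega0) ∧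
    (∃ α : Ordinal.{0}, ActOmega.IsClosureOrdinal (ActOmega.immDer V) α ∧
      α ≤ Ordinal.omega0 ^ Ordinal.omega0) :=
  ⟨ActOmega.exists_isClosureOrdinal_le (fun _ _ => .inl) ActOmega.monotone_immDerFin
      ActOmega.decreasesAlong_immDerFin fun s => s.val.measure_lt_opow,
    ActOmega.exists_isClosureOrdinal_le (fun _ _ => .inl) ActOmega.monotone_immDer
      ActOmega.decreasesAlong_immDer fun s => s.val.measure_lt_opow⟩
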